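/- Let $\mathsf C$ be a triangulated category with suspension $\Sigma$. Let $\mathsf{Ab}\,\mathsf C$ be its abelianisation, that is, the category of additive functors $F\colon\mathsf C^{\mathrm{op}}\to\mathsf{Ab}$ into abelian groups that admit an exact copresentation $0\to F\to\operatorname{Hom}(-,A)\to\operatorname{Hom}(-,B)$ with $A,B\in\mathsf C$; for $n\in\mathbb Z$ put $\Sigma^nF=F\circ\Sigma^{-n}$, so that $\Sigma^n\operatorname{Hom}(-,C)\cong\operatorname{Hom}(-,\Sigma^nC)$. A function $\chi\colon\operatorname{Ob}\mathsf{Ab}\,\mathsf C\to\mathbb N$ is called additive if (1) $\chi(F)=\chi(F')+\chi(F'')$ for each exact sequence $0\to F'\to F\to F''\to 0$ in $\mathsf{Ab}\,\mathsf C$, and (2) for each $F$ there is some $n\in\mathbb Z$ with $\chi(\Sigma^nF)=0$. A function $\chi\colon\operatorname{Ob}\mathsf C\to\mathbb N$ is called cohomological if (1) $\chi(D)=\chi(C)+\chi(C')$ whenever $D$ is a direct sum of objects $C$ and $C'$, (2) for each object $C$ there is some $n\in\mathbb Z$ with $\chi(\Sigma^nC)=0$, and (3) for each exact triangle $A\to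 B\to C\to\Sigma A$ and each labelling $\cdots\to X_{-1}\to X_0\to X_1\to\cdots$ of the induced sequence $\cdots\to\Sigma^{-1}B\to\Sigma^{-1}C\to A\to B\to C\to\Sigma A\to\Sigma B\to\cdots$ with $\chi(X_0)=0$ one has $\sum_{i=0}^n(-1)^{i+n}\chi(X_i)\ge 0$ for all $n\in\mathbb Z$, with equality when $\chi(X_n)=0$; here for $n<0$ the sum runs over $n\le i\le 0$. Then the restriction $\chi\mapsto\big(C\mapsto\chi(\operatorname{Hom}(-,C))\big)$ along the Yoneda embedding is a bijection from the set of additive functions $\operatorname{Ob}\mathsf{Ab}\,\mathsf C\to\mathbb N$ onto the set of cohomological functions $\operatorname{Ob}\mathsf C\to\mathbb N$. Moreover, its inverse is given as follows. Let $\chi$ be an additive function on $\mathsf{Ab}\,\mathsf C$, and write $\chi(X)=\chi(\operatorname{Hom}(-,X))$ for $X\in\mathsf C$. Let $F\in\mathsf{Ab}\,\mathsf C$, let $A\to B\to C\to\Sigma A$ be an exact triangle such that there is an exact sequence $0\to F\to\operatorname{Hom}(-,A)\to\operatorname{Hom}(-,B)$ whose second map is induced by $A\to B$, and let $n\in\mathbb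 Z$ with $\chi(\Sigma^n(A\oplus B\oplus C))=0$. Then $$\chi(F)=\begin{cases}\sum_{i=0}^{n}(-1)^i\big(\chi(\Sigma^iA)-\chi(\Sigma^iB)+\chi(\Sigma^iC)\big)&\text{if }n\ge 0,\\ \sum_{i=n}^{-1}(-1)^{i+1}\big(\chi(\Sigma^iA)-\chi(\Sigma^iB)+\chi(\Sigma^iC)\big)&\text{if }n<0.\end{cases}$$ -/

import Mathlib

open CategoryTheory Limits Pretriangulated

universe v u

noncomputable section

namespace CohFun

section Abelianisation

variable (C : Type u) [Category.{v} C] [Preadditive C]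

/-- The property of a presheaf of abelian groups on `C` of being an additive functor which admits a
copresentation `0 ⟶ F ⟶ Hom(-, A) ⟶ Hom(-, B)`. Exactness is exactness in the abelian category of
presheaves of abelian groups, that is, objectwise exactness. -/
def isCopresented : ObjectProperty (Cᵒᵖ ⥤ AddCommGrpCat.{v}) := fun F =>
  F.Additive ∧ ∃ (A B : C) (i : F ⟶ preadditiveYoneda.obj A)
    (f : preadditiveYoneda.obj A ⟶ preadditiveYoneda.obj B) (w : i ≫ f = 0),
    Mono i ∧ (ShortComplex.mk i f w).Exact

/-- The abelianisation `Ab C`, a full subcategory of the category of presheaves. -/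
abbrev Abelianisation := (isCopresented C).FullSubcategory

variable {C}

lemma isCopresented_yoneda (X : C) : isCopresented C (preadditiveYoneda.obj X) := by
  refine ⟨inferInstance, X, X, 𝟙 _, 0, by simp, inferInstance, ?_⟩
  rw [ShortComplex.exact_iff_epi _ rfl]
  dsimp
  infer_instance

variable (C) in
/-- The Yoneda embedding `C ⥤ Ab C`, `X ↦ Hom(-, X)`. -/
def yonedaAb : C ⥤ Abelianisation C :=
  (isCopresented C).lift preadditiveYoneda isCopresented_yoneda

end Abelianisation

section Shift

variable {C : Type u} [Category.{v} C] [Preadditive C] [HasShift C ℤ]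
  [∀ n : ℤ, (shiftFunctor C n).Additive]

/-- The isomorphism `Hom(Σ⁻ⁿ -, X) ≅ Hom(-, Σⁿ X)`. -/
def yonedaShiftIso (n : ℤ) (X : C) :
    (shiftFunctor C (-n)).op ⋙ preadditiveYoneda.obj X ≅ preadditiveYoneda.obj (X⟦n⟧) :=
  NatIso.ofComponents
    (fun Y =>
      have : (shiftEquiv' C (-n) n (neg_add_cancel n)).functor.Additive :=
        inferInstanceAs (shiftFunctor C (-n)).Additive
      ((shiftEquiv' C (-n) n (neg_add_cancel n)).toAdjunction.homAddEquiv
        Y.unop X).toAddCommGrpIso)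
    (fun g => by
      ext y
      exact (shiftEquiv' C (-n) n (neg_add_cancel n)).toAdjunction.homEquiv_naturality_left
        g.unop y)

lemma isCopresented_shift (n : ℤ) {F : Cᵒᵖ ⥤ AddCommGrpCat.{v}} (hF : isCopresented C F) :
    isCopresented C ((shiftFunctor C (-n)).op ⋙ F) := by
  obtain ⟨hadd, A, B, i, f, w, hi, hex⟩ := hF
  let W : (Cᵒᵖ ⥤ AddCommGrpCat.{v}) ⥤ (Cᵒᵖ ⥤ AddCommGrpCat.{v}) :=
    (Functor.whiskeringLeft _ _ _).obj (shiftFunctor C (-n)).op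
  have : PreservesFiniteLimits W := ⟨fun _ ↦ inferInstance⟩
  have : PreservesFiniteColimits W := ⟨fun _ ↦ inferInstance⟩
  have : W.PreservesZeroMorphisms := ⟨fun _ _ => rfl⟩
  have hW := hex.map W
  have : Mono (W.map i) := inferInstance
  refine ⟨inferInstance, A⟦n⟧, B⟦n⟧, W.map i ≫ (yonedaShiftIso n A).hom,
    (yonedaShiftIso n A).inv ≫ W.map f ≫ (yonedaShiftIso n B).hom, ?_, mono_comp _ _, ?_⟩
  · have h0 : W.map i ≫ W.map f = 0 := by rw [← W.map_comp, w, W.map_zero]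
    simp [reassoc_of% h0]
  · refine (ShortComplex.exact_iff_of_iso ?_).1 hW
    exact ShortComplex.isoMk (Iso.refl _) (yonedaShiftIso n A) (yonedaShiftIso n B)
      (Category.id_comp _) (Iso.hom_inv_id_assoc _ _)

/-- The suspension `Σⁿ` on `Ab C`: it sends `F` to `F ∘ Σ⁻ⁿ`, hence `Hom(-, X)` to a functor
isomorphic to `Hom(-, Σⁿ X)`. -/
def shiftAb (n : ℤ) (F : Abelianisation C) : Abelianisation C :=
  ⟨(shiftFunctor C (-n)).op ⋙ F.obj, isCopresented_shift n F.property⟩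

/-- Additive functions `Ob (Ab C) → ℕ`. A short exact sequence of `Ab C` is one of presheaves:
the full subcategory `Ab C` is closed under kernels and cokernels. -/
structure IsAdditiveFunction (χ : Abelianisation C → ℕ) : Prop where
  map_shortExact : ∀ S : ShortComplex (Abelianisation C),
    (S.map (isCopresented C).ι).ShortExact → χ S.X₂ = χ S.X₁ + χ S.X₃
  exists_shift_eq_zero : ∀ F : Abelianisation C, ∃ n : ℤ, χ (shiftAb n F) = 0

/-- The objects of the sequence `⋯ → Σ⁻¹B → Σ⁻¹C → A → B → C → ΣA → ΣB → ⋯` induced by a triangle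
`A → B → C → ΣA`, labelled so that `A` sits in position `0`. -/
def triangleSeq (T : Triangle C) (i : ℤ) : C :=
  if i % 3 = 0 then T.obj₁⟦i / 3⟧ else if i % 3 = 1 then T.obj₂⟦i / 3⟧ else T.obj₃⟦i / 3⟧

/-- The sum `∑_{i=0}^{n} (-1)^{i+n} x_i`; for negative `n` the sum runs over `n ≤ i ≤ 0`. -/
def altSum (x : ℤ → ℕ) (n : ℤ) : ℤ :=
  ∑ i ∈ Finset.uIcc 0 n, ((i + n).negOnePow : ℤ) * (x i : ℤ)

variable [HasZeroObject C] [Pretriangulated C]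

/-- Cohomological functions `Ob C → ℕ`. All labellings of the sequence induced by a triangle are
obtained from `triangleSeq` by a translation of the indices by some `k`. -/
structure IsCohomologicalFunction (χ : C → ℕ) : Prop where
  map_biprod : ∀ (X Y : C) (b : BinaryBicone X Y), b.IsBilimit → χ b.pt = χ X + χ Y
  exists_shift_eq_zero : ∀ X : C, ∃ n : ℤ, χ (X⟦n⟧) = 0
  altSum_nonneg : ∀ T ∈ distTriang C, ∀ k : ℤ, χ (triangleSeq T k) = 0 →
    ∀ n : ℤ, 0 ≤ altSum (fun i => χ (triangleSeq T (i + k))) n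
  altSum_eq_zero : ∀ T ∈ distTriang C, ∀ k : ℤ, χ (triangleSeq T k) = 0 →
    ∀ n : ℤ, χ (triangleSeq T (n + k)) = 0 →
      altSum (fun i => χ (triangleSeq T (i + k))) n = 0

/-- The alternating sum attached to a function `χ`, a triangle `A → B → C → ΣA` and an integer `n`:
`∑_{i=0}^{n} (-1)^i (χ(ΣⁱA) - χ(ΣⁱB) + χ(ΣⁱC))` if `n ≥ 0`, and
`∑_{i=n}^{-1} (-1)^{i+1} (χ(ΣⁱA) - χ(ΣⁱB) + χ(ΣⁱC))` if `n < 0`. -/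
def extensionSum (χ : C → ℕ) (T : Triangle C) (n : ℤ) : ℤ :=
  if 0 ≤ n then
    ∑ i ∈ Finset.Icc 0 n, (i.negOnePow : ℤ) *
      ((χ (T.obj₁⟦i⟧) : ℤ) - (χ (T.obj₂⟦i⟧) : ℤ) + (χ (T.obj₃⟦i⟧) : ℤ))
  else
    ∑ i ∈ Finset.Icc n (-1), ((i + 1).negOnePow : ℤ) *
      ((χ (T.obj₁⟦i⟧) : ℤ) - (χ (T.obj₂⟦i⟧) : ℤ) + (χ (T.obj₃⟦i⟧) : ℤ))

end Shift

end CohFun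

end

noncomputable section

namespace CohFun

/-! A triangle induces a long exact sequence of representables `Hom(-, X n)`. Cutting it into short
exact sequences, an additive `χ` satisfies `χ (X n) = K n + K (n + 1)`, where `K n` is its value on
the kernel of the map leaving `X n` (`exists_syzygies`). Alternating sums that start where `χ`
vanishes therefore telescope to a single `K`. This gives the cohomological inequalities, and also
the formula for `χ F = K 0`, which makes restriction injective.

Conversely, for a cohomological `χ` the formula is taken as a definition. Its independence of `n`
and its nonnegativity are the two alternating sum axioms. Independence of the copresentation and
additivity are proved degreewise, for the defect `χ A - χ B + χ (cone f)` with `χ` replaced by `χ ∘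
Σⁿ`; only additivity on direct sums is then needed. The key is `defect_comp`: by the octahedral
axiom the defect is additive on a composite `f ≫ g` when everything killed by `g` factors through
`f`. Any two copresentations of a functor agree after enlarging source and target by split
monomorphisms, which do not change the defect, and each short exact sequence in `Ab C` comes from a
composite of this kind. -/

lemma exact_iff_exact_evaluation {J : Type*} [Category* J] {V : Type*} [Category* V] [Abelian V]
    (S : ShortComplex (J ⥤ V)) :
    S.Exact ↔ ∀ j : J, (S.map ((evaluation J V).obj j)).Exact := by
  simp only [ShortComplex.exact_iff_isZero_homology]
  rw [Functor.isZero_iff]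
  exact forall_congr' fun j => (S.mapHomologyIso ((evaluation J V).obj j)).symm.isZero_iff

section

variable {J : Type*} [Category* J] (S : ShortComplex (J ⥤ AddCommGrpCat.{v}))

lemma exact_iff_forall_apply :
    S.Exact ↔ ∀ (j : J) (x : S.X₂.obj j), S.g.app j x = 0 → ∃ y : S.X₁.obj j, S.f.app j y = x := by
  rw [exact_iff_exact_evaluation]
  exact forall_congr' fun j => ShortComplex.ab_exact_iff _

lemma mono_iff_injective_app {F G : J ⥤ AddCommGrpCat.{v}} (α : F ⟶ G) :
    Mono α ↔ ∀ j, Function.Injective (α.app j) := by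
  rw [NatTrans.mono_iff_mono_app]
  exact forall_congr' fun j => AddCommGrpCat.mono_iff_injective _

lemma epi_iff_surjective_app {F G : J ⥤ AddCommGrpCat.{v}} (α : F ⟶ G) :
    Epi α ↔ ∀ j, Function.Surjective (α.app j) := by
  rw [NatTrans.epi_iff_epi_app]
  exact forall_congr' fun j => AddCommGrpCat.epi_iff_surjective _

end

/-! ### Copresentations in terms of elements -/

variable {C : Type u} [Category.{v} C] [Preadditive C]

/-- The morphism `X ⟶ A` given by a map `F ⟶ Hom(-, A)` and an element of `F X`. -/
def evalHom {F : Cᵒᵖ ⥤ AddCommGrpCat.{v}} {A X : C} (i : F ⟶ preadditiveYoneda.obj A)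
    (t : F.obj (Opposite.op X)) : X ⟶ A :=
  i.app (Opposite.op X) t

section

variable {F : Cᵒᵖ ⥤ AddCommGrpCat.{v}} {A X : C} (i : F ⟶ preadditiveYoneda.obj A)

lemma evalHom_map {Y : C} (r : X ⟶ Y) (t : F.obj (Opposite.op Y)) :
    evalHom i (F.map r.op t) = r ≫ evalHom i t :=
  ConcreteCategory.congr_hom (i.naturality r.op) t

lemma evalHom_comp {B : C} (u : A ⟶ B) (t : F.obj (Opposite.op X)) :
    evalHom (i ≫ preadditiveYoneda.map u) t = evalHom i t ≫ u := rfl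

lemma evalHom_zero : evalHom i (0 : F.obj (Opposite.op X)) = 0 :=
  map_zero (i.app (Opposite.op X)).hom

lemma evalHom_add (s t : F.obj (Opposite.op X)) :
    evalHom i (s + t) = evalHom i s + evalHom i t :=
  map_add (i.app (Opposite.op X)).hom s t

end

/-- A copresentation `0 ⟶ F ⟶ Hom(-, A) ⟶ Hom(-, B)`, expressed in terms of elements. -/
structure IsCopresentation {F : Cᵒᵖ ⥤ AddCommGrpCat.{v}} {A B : C}
    (i : F ⟶ preadditiveYoneda.obj A) (f : A ⟶ B) : Prop where
  injective (X : Cᵒᵖ) : Function.Injective (i.app X)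
  exact {X : C} (x : X ⟶ A) : x ≫ f = 0 ↔ ∃ t : F.obj (Opposite.op X), evalHom i t = x

lemma isCopresentation_iff {F : Cᵒᵖ ⥤ AddCommGrpCat.{v}} {A B : C}
    (i : F ⟶ preadditiveYoneda.obj A) (f : A ⟶ B) :
    IsCopresentation i f ↔ Mono i ∧
      ∃ w : i ≫ preadditiveYoneda.map f = 0,
        (ShortComplex.mk i (preadditiveYoneda.map f) w).Exact := by
  constructor
  · intro h
    refine ⟨(mono_iff_injective_app i).2 h.injective, ?_, ?_⟩
    · ext X t
      exact (h.exact _).2 ⟨t, rfl⟩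
    · rw [exact_iff_forall_apply]
      intro X x hx
      exact (h.exact x).1 hx
  · rintro ⟨hi, w, h⟩
    refine ⟨(mono_iff_injective_app i).1 hi, fun {X} x => ⟨fun hx => ?_, ?_⟩⟩
    · exact (exact_iff_forall_apply _).1 h (Opposite.op X) x hx
    · rintro ⟨t, rfl⟩
      exact ConcreteCategory.congr_hom (NatTrans.congr_app w (Opposite.op X)) t

lemma exists_isCopresentation {F : Cᵒᵖ ⥤ AddCommGrpCat.{v}} (hF : isCopresented C F) :
    ∃ (A B : C) (i : F ⟶ preadditiveYoneda.obj A) (f : A ⟶ B), IsCopresentation i f := by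
  obtain ⟨_, A, B, i, f, w, hi, h⟩ := hF
  obtain ⟨f, rfl⟩ := preadditiveYoneda.map_surjective f
  exact ⟨A, B, i, f, (isCopresentation_iff i f).2 ⟨hi, w, h⟩⟩

lemma additive_of_mono {F G : Cᵒᵖ ⥤ AddCommGrpCat.{v}} (i : F ⟶ G) (hi : Mono i) [G.Additive] :
    F.Additive where
  map_add {X Y f g} := by
    have := (NatTrans.mono_iff_mono_app i).1 hi Y
    rw [← cancel_mono (i.app Y)]
    simp [Functor.map_add]

lemma IsCopresentation.isCopresented {F : Cᵒᵖ ⥤ AddCommGrpCat.{v}} {A B : C}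
    {i : F ⟶ preadditiveYoneda.obj A} {f : A ⟶ B} (h : IsCopresentation i f) :
    isCopresented C F := by
  obtain ⟨hi, w, hex⟩ := (isCopresentation_iff i f).1 h
  exact ⟨additive_of_mono i hi, A, B, i, _, w, hi, hex⟩

lemma isCopresentation_kernel {A B : C} (f : A ⟶ B) :
    IsCopresentation (kernel.ι (preadditiveYoneda.map f)) f :=
  (isCopresentation_iff _ _).2 ⟨inferInstance, kernel.condition _,
    ShortComplex.exact_of_f_is_kernel _ (kernelIsKernel _)⟩

/-- The kernel of `Hom(-, A) ⟶ Hom(-, B)`, as an object of the abelianisation. -/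
def kernelAb {A B : C} (f : A ⟶ B) : Abelianisation C :=
  ⟨kernel (preadditiveYoneda.map f), (isCopresentation_kernel f).isCopresented⟩

lemma IsCopresentation.ext {F : Cᵒᵖ ⥤ AddCommGrpCat.{v}} {A B X : C}
    {i : F ⟶ preadditiveYoneda.obj A} {f : A ⟶ B} (h : IsCopresentation i f)
    {s t : F.obj (Opposite.op X)} (hst : evalHom i s = evalHom i t) : s = t :=
  h.injective _ hst

/-! ### Alternating sums and discrete primitives -/

lemma sum_Icc_sub {a b : ℤ} (q : ℤ → ℤ) (h : a ≤ b + 1) :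
    ∑ i ∈ Finset.Icc a b, (q (i + 1) - q i) = q (b + 1) - q a := by
  obtain ⟨c, rfl⟩ : ∃ c, b = c - 1 := ⟨b + 1, by ring⟩
  have hc : a ≤ c := by omega
  clear h
  induction c, hc using Int.leInduction with
  | base => simp
  | succ n hn ih =>
    have : Finset.Icc a (n + 1 - 1) = insert n (Finset.Icc a (n - 1)) := by
      ext; simp only [Finset.mem_Icc, Finset.mem_insert]; omega
    rw [this, Finset.sum_insert (by simp), ih]
    simp

lemma negOnePow_mul_self (n : ℤ) : (n.negOnePow : ℤ) * n.negOnePow = 1 := by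
  rw [← Units.val_mul, ← Int.negOnePow_add, Int.negOnePow_even _ (Even.add_self n), Units.val_one]

/-- `q` is a discrete primitive of `n ↦ (-1)ⁿ y n`. -/
def IsAltPrimitive (y q : ℤ → ℤ) : Prop := ∀ n, q (n + 1) = q n + (n.negOnePow : ℤ) * y n

lemma exists_isAltPrimitive (y : ℤ → ℤ) : ∃ q, IsAltPrimitive y q ∧ q 0 = 0 := by
  refine ⟨fun n => if 0 ≤ n then ∑ i ∈ Finset.Icc 0 (n - 1), (i.negOnePow : ℤ) * y i
    else -∑ i ∈ Finset.Icc n (-1), (i.negOnePow : ℤ) * y i, fun n => ?_, by simp⟩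
  dsimp only
  rcases lt_or_ge n 0 with hn | hn
  · have h : Finset.Icc n (-1) = insert n (Finset.Icc (n + 1) (-1)) := by
      ext; simp only [Finset.mem_Icc, Finset.mem_insert]; omega
    rw [if_neg hn.not_ge, h, Finset.sum_insert (by simp)]
    split_ifs with h'
    · obtain rfl : n = -1 := by omega
      simp
    · ring
  · have h : Finset.Icc 0 (n + 1 - 1) = insert n (Finset.Icc 0 (n - 1)) := by
      ext; simp only [Finset.mem_Icc, Finset.mem_insert]; omega
    rw [if_pos (by omega), if_pos hn, h, Finset.sum_insert (by simp)]
    ring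

namespace IsAltPrimitive

variable {y q : ℤ → ℤ}

lemma negOnePow_mul_eq (h : IsAltPrimitive y q) (n : ℤ) :
    (n.negOnePow : ℤ) * y n = q (n + 1) - q n := by
  rw [h n]; ring

lemma succ_eq_of_eq_zero (h : IsAltPrimitive y q) {n : ℤ} (hn : y n = 0) : q (n + 1) = q n := by
  rw [h n, hn, mul_zero, add_zero]

lemma of_add {K : ℤ → ℤ} (hK : ∀ n, y n = K n + K (n + 1)) :
    IsAltPrimitive y (fun n => -((n.negOnePow : ℤ) * K n)) := fun n => by
  dsimp only
  rw [hK, Int.negOnePow_succ]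
  push_cast
  ring

/-- Grouping the terms of an alternating sum by three. -/
lemma group_three (h : IsAltPrimitive y q) :
    IsAltPrimitive (fun n => y (3 * n) - y (3 * n + 1) + y (3 * n + 2)) (fun n => q (3 * n)) := by
  intro n
  dsimp only
  have h3 : (3 * n).negOnePow = n.negOnePow := by
    rw [show 3 * n = n + (n + n) by ring, Int.negOnePow_add,
      Int.negOnePow_even _ (Even.add_self n), mul_one]
  have h0 := h (3 * n)
  have h1 := h (3 * n + 1)
  have h2 := h (3 * n + 1 + 1)
  rw [Int.negOnePow_succ, Int.negOnePow_succ, h3] at h2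
  rw [Int.negOnePow_succ, h3] at h1
  rw [h3] at h0
  rw [show 3 * (n + 1) = 3 * n + 1 + 1 + 1 by ring, h2, h1, h0,
    show 3 * n + 1 + 1 = 3 * n + 2 by ring]
  push_cast
  ring

end IsAltPrimitive

/-- Both sign conventions telescope. For negative `n` the sum ends at `q (k + 1)`, which equals `q
k` because `y k = 0`. -/
lemma altSum_eq {y : ℤ → ℕ} {q : ℤ → ℤ} (h : IsAltPrimitive (fun n => y n) q) {k : ℤ}
    (hk : y k = 0) (n : ℤ) :
    altSum (fun i => y (i + k)) n = if 0 ≤ n then ((n + k).negOnePow : ℤ) * (q (n + k + 1) - q k)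
      else ((n + k).negOnePow : ℤ) * (q k - q (n + k)) := by
  have key (i : ℤ) : ((i + n).negOnePow : ℤ) * (y (i + k) : ℤ) =
      ((n + k).negOnePow : ℤ) * (q (i + 1 + k) - q (i + k)) := by
    rw [show i + 1 + k = i + k + 1 by ring, ← h.negOnePow_mul_eq, ← mul_assoc, ← Units.val_mul,
      ← Int.negOnePow_add, show n + k + (i + k) = i + n + (k + k) by ring,
      Int.negOnePow_add (i + n), Int.negOnePow_even _ (Even.add_self k), mul_one]
  rw [altSum, Finset.sum_congr rfl fun i _ => key i, ← Finset.mul_sum]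
  split_ifs with hn
  · rw [Finset.uIcc_of_le hn, sum_Icc_sub (fun i => q (i + k)) (by omega), zero_add,
      show n + 1 + k = n + k + 1 by ring]
  · have := h.succ_eq_of_eq_zero (n := k) (by rw [hk, Nat.cast_zero])
    rw [Finset.uIcc_of_ge (by omega), sum_Icc_sub (fun i => q (i + k)) (by omega),
      show (0 : ℤ) + 1 + k = k + 1 by ring, this]

section

variable {C : Type u} [Category.{v} C] [HasShift C ℤ]

/-- The integer `χ(ΣⁿA) - χ(ΣⁿB) + χ(ΣⁿC)` attached to a triangle `A → B → C → ΣA`. -/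
def euler (χ : C → ℕ) (T : Triangle C) (n : ℤ) : ℤ :=
  (χ (T.obj₁⟦n⟧) : ℤ) - (χ (T.obj₂⟦n⟧) : ℤ) + (χ (T.obj₃⟦n⟧) : ℤ)

/-- A primitive merges the two cases of the definition: for `n ≥ 0` the sum reaches `q (n + 1)`,
which is `q n` as the last term vanishes. -/
lemma extensionSum_eq {χ : C → ℕ} {T : Triangle C} {q : ℤ → ℤ}
    (h : IsAltPrimitive (euler χ T) q) {n : ℤ} (hn : euler χ T n = 0) :
    extensionSum χ T n = q n - q 0 := by
  have hn' := h.succ_eq_of_eq_zero hn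
  have key (i : ℤ) : (i.negOnePow : ℤ) * ((χ (T.obj₁⟦i⟧) : ℤ) - (χ (T.obj₂⟦i⟧) : ℤ) +
      (χ (T.obj₃⟦i⟧) : ℤ)) = q (i + 1) - q i := h.negOnePow_mul_eq i
  rw [extensionSum]
  split_ifs with h0
  · rw [Finset.sum_congr rfl fun i _ => key i, sum_Icc_sub q (by omega), hn']
  · have key' (i : ℤ) : ((i + 1).negOnePow : ℤ) * ((χ (T.obj₁⟦i⟧) : ℤ) - (χ (T.obj₂⟦i⟧) : ℤ) +
      (χ (T.obj₃⟦i⟧) : ℤ)) = -(q (i + 1) - q i) := by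
      rw [← key, Int.negOnePow_succ]
      push_cast
      ring
    rw [Finset.sum_congr rfl fun i _ => key' i, Finset.sum_neg_distrib, sum_Icc_sub q (by omega)]
    simp

lemma triangleSeq_three_mul (T : Triangle C) (n : ℤ) : triangleSeq T (3 * n) = T.obj₁⟦n⟧ := by
  rw [triangleSeq, if_pos (by omega), show 3 * n / 3 = n by omega]

lemma triangleSeq_three_mul_add_one (T : Triangle C) (n : ℤ) :
    triangleSeq T (3 * n + 1) = T.obj₂⟦n⟧ := by
  rw [triangleSeq, if_neg (by omega), if_pos (by omega), show (3 * n + 1) / 3 = n by omega]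

lemma triangleSeq_three_mul_add_two (T : Triangle C) (n : ℤ) :
    triangleSeq T (3 * n + 2) = T.obj₃⟦n⟧ := by
  rw [triangleSeq, if_neg (by omega), if_neg (by omega), show (3 * n + 2) / 3 = n by omega]

lemma isAltPrimitive_euler {χ : C → ℕ} {T : Triangle C} {q : ℤ → ℤ}
    (h : IsAltPrimitive (fun n => χ (triangleSeq T n)) q) :
    IsAltPrimitive (euler χ T) (fun n => q (3 * n)) := by
  have := h.group_three
  simp only [triangleSeq_three_mul, triangleSeq_three_mul_add_one,
    triangleSeq_three_mul_add_two] at this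
  exact this

end

/-! ### Functions additive on direct sums -/

section

variable {C : Type u} [Category.{v} C] [Preadditive C]

lemma shortExact_of_apply {F G H : Abelianisation C} {α : F ⟶ G} {β : G ⟶ H} (w : α ≫ β = 0)
    (hα : ∀ X, Function.Injective (α.hom.app X)) (hβ : ∀ X, Function.Surjective (β.hom.app X))
    (h : ∀ X (x : G.obj.obj X), β.hom.app X x = 0 → ∃ y : F.obj.obj X, α.hom.app X y = x) :
    ((ShortComplex.mk α β w).map (isCopresented C).ι).ShortExact where
  exact := (exact_iff_forall_apply _).2 h
  mono_f := (mono_iff_injective_app _).2 hα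
  epi_g := (epi_iff_surjective_app _).2 hβ

lemma IsCopresentation.of_iso {F : Cᵒᵖ ⥤ AddCommGrpCat.{v}} {A B A' B' : C}
    {i : F ⟶ preadditiveYoneda.obj A} {f : A ⟶ B} (h : IsCopresentation i f) (a : A ≅ A')
    (b : B ⟶ B') [Mono b] (f' : A' ⟶ B') (w : f ≫ b = a.hom ≫ f') :
    IsCopresentation (i ≫ preadditiveYoneda.map a.hom) f' where
  injective X s t hst := h.injective X (by
    have : (i.app X s : X.unop ⟶ A) ≫ a.hom = (i.app X t : X.unop ⟶ A) ≫ a.hom := hst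
    exact (cancel_mono a.hom).1 this)
  exact {X} x := by
    trans (x ≫ a.inv) ≫ f = 0
    · rw [← cancel_mono b, Category.assoc, Category.assoc, w, zero_comp, a.inv_hom_id_assoc]
    · rw [h.exact]
      refine exists_congr fun t => ?_
      trans (i.app _ t : X ⟶ A) ≫ a.hom = x
      · exact (Iso.eq_comp_inv a)
      · rfl

lemma shortExact_yonedaAb_of_isBilimit {X Y : C} (b : BinaryBicone X Y) (hb : b.IsBilimit) :
    ((ShortComplex.mk ((yonedaAb C).map b.inl) ((yonedaAb C).map b.snd)
      (by rw [← Functor.map_comp, b.inl_snd]; ext; exact comp_zero)).map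
        (isCopresented C).ι).ShortExact := by
  have total : b.fst ≫ b.inl + b.snd ≫ b.inr = 𝟙 b.pt := IsBilimit.binary_total hb
  refine shortExact_of_apply _ (fun Z (x y : Z.unop ⟶ X) hxy => ?_)
    (fun Z (x : Z.unop ⟶ Y) => ⟨x ≫ b.inr, ?_⟩)
    (fun Z (x : Z.unop ⟶ b.pt) hx => ⟨x ≫ b.fst, ?_⟩)
  · have h : x ≫ b.inl = y ≫ b.inl := hxy
    have h' := h =≫ b.fst
    rwa [Category.assoc, Category.assoc, b.inl_fst, Category.comp_id, Category.comp_id] at h'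
  · change (x ≫ b.inr) ≫ b.snd = x
    simp
  · change x ≫ b.snd = 0 at hx
    change (x ≫ b.fst) ≫ b.inl = x
    rw [← Category.comp_id x, ← total]
    simp [reassoc_of% hx]

end

/-- Functions on objects which are additive on direct sums. -/
def IsSplitAdditive {C : Type u} [Category.{v} C] [Preadditive C] (χ : C → ℕ) : Prop :=
  ∀ (X Y : C) (b : BinaryBicone X Y), b.IsBilimit → χ b.pt = χ X + χ Y

namespace IsSplitAdditive

section

variable {C : Type u} [Category.{v} C] [Preadditive C] {χ : C → ℕ} (h : IsSplitAdditive χ)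
include h

/-- A zero object is its own direct sum with itself. -/
lemma eq_zero_of_isZero {X : C} (hX : IsZero X) : χ X = 0 := by
  have := h X X ⟨X, 0, 0, 0, 0, hX.eq_of_src _ _, hX.eq_of_src _ _, hX.eq_of_src _ _,
    hX.eq_of_src _ _⟩ (isBinaryBilimitOfTotal _ (hX.eq_of_src _ _))
  dsimp only at this
  omega

-- The object `Y` is a direct sum of `X` and `0`.
open ZeroObject in
lemma of_iso [HasZeroObject C] {X Y : C} (e : X ≅ Y) : χ X = χ Y := by
  have := h X 0 ⟨Y, e.inv, 0, e.hom, 0, by simp, by simp, by simp, by simp⟩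
    (isBinaryBilimitOfTotal _ (by simp))
  dsimp only at this
  rw [this, h.eq_zero_of_isZero (isZero_zero C), add_zero]

lemma biprod [HasBinaryBiproducts C] (X Y : C) : χ (X ⊞ Y) = χ X + χ Y :=
  h X Y _ (BinaryBiproduct.isBilimit X Y)

lemma comp {D : Type*} [Category* D] [Preadditive D] (G : D ⥤ C) [G.Additive] :
    IsSplitAdditive (fun X => χ (G.obj X)) := fun X Y b hb => by
  have total : b.fst ≫ b.inl + b.snd ≫ b.inr = 𝟙 b.pt := IsBilimit.binary_total hb
  exact h _ _ (G.mapBinaryBicone b) (isBinaryBilimitOfTotal _ (by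
    change G.map b.fst ≫ G.map b.inl + G.map b.snd ≫ G.map b.inr = 𝟙 (G.obj b.pt)
    rw [← G.map_comp, ← G.map_comp, ← G.map_add, total, G.map_id]))

end

end IsSplitAdditive

lemma IsAdditiveFunction.isSplitAdditive {C : Type u} [Category.{v} C] [Preadditive C]
    [HasShift C ℤ] [∀ n : ℤ, (shiftFunctor C n).Additive] {χ : Abelianisation C → ℕ}
    (hχ : IsAdditiveFunction χ) : IsSplitAdditive (fun X => χ ((yonedaAb C).obj X)) :=
  fun _ _ b hb => hχ.map_shortExact _ (shortExact_yonedaAb_of_isBilimit b hb)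

/-! ### Additive functions restrict to cohomological functions -/

section

variable {C : Type u} [Category.{v} C] [Preadditive C] [HasZeroObject C] [HasShift C ℤ]
  [∀ n : ℤ, (shiftFunctor C n).Additive] [Pretriangulated C]

variable {χ : Abelianisation C → ℕ} (hχ : IsAdditiveFunction χ)
include hχ

/-- Exactness of the long sequence at `T.obj₂` identifies the image of `Hom(-, T.mor₁)` with `G`, so
`0 ⟶ F ⟶ Hom(-, T.obj₁) ⟶ G ⟶ 0` is exact. -/
lemma IsAdditiveFunction.yonedaAb_eq {T : Triangle C} (hT : T ∈ distTriang C)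
    {F G : Abelianisation C} {i : F.obj ⟶ preadditiveYoneda.obj T.obj₁}
    {j : G.obj ⟶ preadditiveYoneda.obj T.obj₂} (hi : IsCopresentation i T.mor₁)
    (hj : IsCopresentation j T.mor₂) : χ ((yonedaAb C).obj T.obj₁) = χ F + χ G := by
  obtain ⟨_, wi, hi'⟩ := (isCopresentation_iff _ _).1 hi
  obtain ⟨_, wj, hj'⟩ := (isCopresentation_iff _ _).1 hj
  let p : preadditiveYoneda.obj T.obj₁ ⟶ G.obj := hj'.lift (preadditiveYoneda.map T.mor₁) (by
    dsimp
    rw [← Functor.map_comp, comp_distTriang_mor_zero₁₂ _ hT]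
    ext
    exact comp_zero)
  have hp : p ≫ j = preadditiveYoneda.map T.mor₁ := hj'.lift_f _ _
  have hp' (X : C) (x : X ⟶ T.obj₁) : j.app (Opposite.op X) (p.app (Opposite.op X) x) =
      x ≫ T.mor₁ := ConcreteCategory.congr_hom (NatTrans.congr_app hp (Opposite.op X)) x
  let α : F ⟶ (yonedaAb C).obj T.obj₁ := ⟨i⟩
  let β : (yonedaAb C).obj T.obj₁ ⟶ G := ⟨p⟩
  have w : α ≫ β = 0 := by
    ext : 1
    change i ≫ p = 0
    rw [← cancel_mono j, Category.assoc, hp, wi, zero_comp]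
  refine hχ.map_shortExact _ (shortExact_of_apply w hi.injective (fun X t => ?_) (fun X x hx => ?_))
  · obtain ⟨x, hx⟩ := T.coyoneda_exact₂ hT (j.app X t : X.unop ⟶ T.obj₂)
      ((hj.exact _).2 ⟨t, rfl⟩)
    exact ⟨x, hj.injective X ((hp' _ _).trans hx.symm)⟩
  · refine (hi.exact (X := X.unop) x).1 ?_
    rw [← hp' X.unop x]
    refine (congrArg _ hx).trans (map_zero _)

end

lemma altSum_eq_of_add {y K : ℤ → ℕ} (hK : ∀ n, y n = K n + K (n + 1)) {k : ℤ} (hk : y k = 0)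
    (n : ℤ) : altSum (fun i => y (i + k)) n = if 0 ≤ n then K (n + k + 1) else K (n + k) := by
  have hq : IsAltPrimitive (fun n => (y n : ℤ)) (fun n => -((n.negOnePow : ℤ) * K n)) :=
    .of_add (K := fun n => (K n : ℤ)) fun n => by rw [hK]; push_cast; rfl
  have hk0 : K k = 0 := by have := hK k; omega
  rw [altSum_eq hq hk]
  rw [hk0, Int.negOnePow_succ]
  push_cast
  have := negOnePow_mul_self (n + k)
  split_ifs
  · linear_combination (K (n + k + 1) : ℤ) * this
  · linear_combination (K (n + k) : ℤ) * this

lemma isCopresentation_zero {C : Type u} [Category.{v} C] [Preadditive C]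
    {F : Cᵒᵖ ⥤ AddCommGrpCat.{v}} {A B : C} (e : F ≅ preadditiveYoneda.obj A) :
    IsCopresentation e.hom (0 : A ⟶ B) where
  injective := (mono_iff_injective_app e.hom).1 inferInstance
  exact x := ⟨fun _ => (epi_iff_surjective_app e.hom).1 inferInstance _ x, fun _ => comp_zero⟩

section

variable {C : Type u} [Category.{v} C] [Preadditive C] [HasZeroObject C] [HasShift C ℤ]
  [∀ n : ℤ, (shiftFunctor C n).Additive] [Pretriangulated C]

namespace IsAdditiveFunction

variable {χ : Abelianisation C → ℕ} (hχ : IsAdditiveFunction χ)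
include hχ

/-- Both values complement the value on the next syzygy to `χ (Hom(-, T.obj₁))`. -/
lemma eq_kernelAb {T : Triangle C} (hT : T ∈ distTriang C) {F : Abelianisation C}
    {i : F.obj ⟶ preadditiveYoneda.obj T.obj₁} (hi : IsCopresentation i T.mor₁) :
    χ F = χ (kernelAb T.mor₁) := by
  have h := hχ.yonedaAb_eq hT hi (G := kernelAb T.mor₂) (isCopresentation_kernel _)
  have h' := hχ.yonedaAb_eq hT (F := kernelAb T.mor₁) (isCopresentation_kernel _)
    (G := kernelAb T.mor₂) (isCopresentation_kernel _)
  omega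

lemma kernelAb_eq_of_iso {T T' : Triangle C} (hT : T ∈ distTriang C) (e : T ≅ T') :
    χ (kernelAb T.mor₁) = χ (kernelAb T'.mor₁) :=
  hχ.eq_kernelAb (isomorphic_distinguished _ hT _ e.symm) (F := kernelAb T.mor₁)
    ((isCopresentation_kernel T.mor₁).of_iso (Triangle.π₁.mapIso e) e.hom.hom₂ _ e.hom.comm₁)

lemma yonedaAb_eq_kernelAb {T : Triangle C} (hT : T ∈ distTriang C) :
    χ ((yonedaAb C).obj T.obj₁) = χ (kernelAb T.mor₁) + χ (kernelAb T.rotate.mor₁) :=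
  hχ.yonedaAb_eq hT (F := kernelAb T.mor₁) (isCopresentation_kernel _)
    (G := kernelAb T.mor₂) (isCopresentation_kernel _)

/-- The values of an additive function on the syzygies of the sequence induced by a triangle. -/
lemma exists_syzygies {T : Triangle C} (hT : T ∈ distTriang C) :
    ∃ K : ℤ → ℕ, (∀ n, χ ((yonedaAb C).obj (triangleSeq T n)) = K n + K (n + 1)) ∧
      K 0 = χ (kernelAb T.mor₁) := by
  let S (i : ℤ) : Triangle C := (Triangle.shiftFunctor C i).obj T
  have hS (i : ℤ) : S i ∈ distTriang C := T.shift_distinguished hT i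
  refine ⟨fun n => if n % 3 = 0 then χ (kernelAb (S (n / 3)).mor₁) else
    if n % 3 = 1 then χ (kernelAb (S (n / 3)).rotate.mor₁)
      else χ (kernelAb (S (n / 3)).rotate.rotate.mor₁), fun n => ?_, ?_⟩
  · obtain ⟨m, rfl | rfl | rfl⟩ : ∃ m, n = 3 * m ∨ n = 3 * m + 1 ∨ n = 3 * m + 2 :=
      ⟨n / 3, by omega⟩
    · dsimp only
      rw [triangleSeq_three_mul, if_pos (by omega), if_neg (by omega), if_pos (by omega),
        show 3 * m / 3 = m by omega, show (3 * m + 1) / 3 = m by omega]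
      exact hχ.yonedaAb_eq_kernelAb (hS m)
    · dsimp only
      rw [triangleSeq_three_mul_add_one, if_neg (by omega), if_pos (by omega), if_neg (by omega),
        if_neg (by omega), show (3 * m + 1) / 3 = m by omega,
        show (3 * m + 1 + 1) / 3 = m by omega]
      exact hχ.yonedaAb_eq_kernelAb (rot_of_distTriang _ (hS m))
    -- The next syzygy belongs to the following shift: rotating `S m` three times gives `S (m + 1)`
    -- up to isomorphism.
    · have h3 := rot_of_distTriang _ (rot_of_distTriang _ (hS m))
      dsimp only
      rw [triangleSeq_three_mul_add_two, if_neg (by omega), if_neg (by omega),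
        if_pos (by omega), show (3 * m + 2) / 3 = m by omega,
        show (3 * m + 2 + 1) / 3 = m + 1 by omega,
        ← hχ.kernelAb_eq_of_iso (rot_of_distTriang _ h3) ((rotateRotateRotateIso C).app (S m) ≪≫
          ((Triangle.shiftFunctorAdd' C m 1 (m + 1) rfl).app T).symm)]
      exact hχ.yonedaAb_eq_kernelAb h3
  · exact (hχ.kernelAb_eq_of_iso hT ((Triangle.shiftFunctorZero C).app T).symm).symm

open ZeroObject in
lemma shiftAb_yonedaAb (X : C) (n : ℤ) :
    χ (shiftAb n ((yonedaAb C).obj X)) = χ ((yonedaAb C).obj (X⟦n⟧)) := by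
  -- Both functors are copresented by the zero map `X⟦n⟧ ⟶ 0`, the first map of this triangle.
  have hT := contractible_distinguished₂ (X⟦n⟧)
  exact (hχ.eq_kernelAb hT (F := shiftAb n ((yonedaAb C).obj X))
    (isCopresentation_zero (yonedaShiftIso n X))).trans
      (hχ.eq_kernelAb hT (F := (yonedaAb C).obj (X⟦n⟧)) (isCopresentation_zero (Iso.refl _))).symm

lemma eq_zero_of_shift {X Y Z : C} {n : ℤ}
    (h : χ ((yonedaAb C).obj ((X ⊞ Y ⊞ Z)⟦n⟧)) = 0) :
    χ ((yonedaAb C).obj (X⟦n⟧)) = 0 ∧ χ ((yonedaAb C).obj (Y⟦n⟧)) = 0 ∧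
      χ ((yonedaAb C).obj (Z⟦n⟧)) = 0 := by
  have h₁ := (hχ.isSplitAdditive.comp (shiftFunctor C n)).biprod X (Y ⊞ Z)
  have h₂ := (hχ.isSplitAdditive.comp (shiftFunctor C n)).biprod Y Z
  omega

theorem eq_extensionSum {T : Triangle C} (hT : T ∈ distTriang C) {F : Abelianisation C}
    {i : F.obj ⟶ preadditiveYoneda.obj T.obj₁} (hi : IsCopresentation i T.mor₁) {n : ℤ}
    (hn : χ ((yonedaAb C).obj ((T.obj₁ ⊞ T.obj₂ ⊞ T.obj₃)⟦n⟧)) = 0) :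
    (χ F : ℤ) = extensionSum (fun X => χ ((yonedaAb C).obj X)) T n := by
  obtain ⟨K, hK, hK0⟩ := hχ.exists_syzygies hT
  obtain ⟨h₁, h₂, h₃⟩ := hχ.eq_zero_of_shift hn
  -- The primitive is `q n = -(-1)ⁿ K n`, so the sum is `q (3 * n) - q 0` with `K (3 * n) = 0`,
  -- which leaves `K 0`.
  have hq := isAltPrimitive_euler (χ := fun X => χ ((yonedaAb C).obj X)) (T := T)
    (.of_add (K := fun n => (K n : ℤ)) fun n => by rw [hK]; push_cast; rfl)
  have hKn : K (3 * n) = 0 := by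
    have := hK (3 * n)
    rw [triangleSeq_three_mul, h₁] at this
    omega
  rw [extensionSum_eq hq (by simp [euler, h₁, h₂, h₃]), hχ.eq_kernelAb hT hi]
  simp [hKn, hK0]

theorem isCohomologicalFunction :
    IsCohomologicalFunction (fun X => χ ((yonedaAb C).obj X)) where
  map_biprod := hχ.isSplitAdditive
  exists_shift_eq_zero X := by
    obtain ⟨n, hn⟩ := hχ.exists_shift_eq_zero ((yonedaAb C).obj X)
    exact ⟨n, (hχ.shiftAb_yonedaAb X n).symm.trans hn⟩
  altSum_nonneg T hT k hk n := by
    obtain ⟨K, hK, -⟩ := hχ.exists_syzygies hT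
    rw [altSum_eq_of_add hK hk]
    split_ifs <;> positivity
  altSum_eq_zero T hT k hk n hn := by
    obtain ⟨K, hK, -⟩ := hχ.exists_syzygies hT
    rw [altSum_eq_of_add hK hk]
    have := hK (n + k)
    split_ifs <;> omega

end IsAdditiveFunction

end

/-! ### Finite generation, and injectivity of representables -/

section

variable {C : Type u} [Category.{v} C] [Preadditive C] [HasZeroObject C] [HasShift C ℤ]
  [∀ n : ℤ, (shiftFunctor C n).Additive] [Pretriangulated C]

/-- The hypothesis is only needed for the fibre of `f`, since `f` is a weak cokernel of it. -/
lemma exists_comp_eq_of_comp_eq_zero {A B Y : C} (f : A ⟶ B) (g : A ⟶ Y)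
    (h : ∀ ⦃X : C⦄ (x : X ⟶ A), x ≫ f = 0 → x ≫ g = 0) : ∃ v : B ⟶ Y, f ≫ v = g := by
  obtain ⟨G, k, w, hT⟩ := distinguished_cocone_triangle₁ f
  obtain ⟨v, hv⟩ := Triangle.yoneda_exact₂ _ hT g (h k (comp_distTriang_mor_zero₁₂ _ hT))
  exact ⟨v, hv.symm⟩

namespace IsCopresentation

variable {F : Cᵒᵖ ⥤ AddCommGrpCat.{v}} {A B : C} {i : F ⟶ preadditiveYoneda.obj A} {f : A ⟶ B}

/-- A functor with a copresentation is finitely generated. -/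
lemma exists_generator (h : IsCopresentation i f) :
    ∃ (G : C) (s : F.obj (Opposite.op G)), ∀ ⦃X : C⦄ (t : F.obj (Opposite.op X)),
      ∃ r : X ⟶ G, F.map r.op s = t := by
  obtain ⟨G, k, w, hT⟩ := distinguished_cocone_triangle₁ f
  obtain ⟨s, hs⟩ := (h.exact k).1 (comp_distTriang_mor_zero₁₂ _ hT)
  refine ⟨G, s, fun X t => ?_⟩
  obtain ⟨r, hr⟩ : ∃ r : X ⟶ G, evalHom i t = r ≫ k :=
    Triangle.coyoneda_exact₂ _ hT _ ((h.exact _).2 ⟨t, rfl⟩)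
  exact ⟨r, h.ext (by rw [evalHom_map, hs, hr])⟩

/-- A generator of `F` gives a morphism `G ⟶ A'` whose image on representables is `F`; its cone
supplies `f'`. -/
lemma exists_of_mono (h : IsCopresentation i f) {A' : C} (j : F ⟶ preadditiveYoneda.obj A')
    (hj : ∀ X, Function.Injective (j.app X)) :
    ∃ (B' : C) (f' : A' ⟶ B'), IsCopresentation j f' := by
  obtain ⟨G, s, hs⟩ := h.exists_generator
  obtain ⟨B', f', w, hT⟩ := distinguished_cocone_triangle (evalHom j s)
  refine ⟨B', f', hj, fun {X} x => ⟨fun hx => ?_, ?_⟩⟩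
  · obtain ⟨r, hr⟩ := Triangle.coyoneda_exact₂ _ hT x hx
    exact ⟨F.map r.op s, (evalHom_map j r s).trans hr.symm⟩
  · rintro ⟨t, rfl⟩
    obtain ⟨r, rfl⟩ := hs t
    have h0 : evalHom j s ≫ f' = 0 := comp_distTriang_mor_zero₁₂ _ hT
    rw [evalHom_map, Category.assoc, h0, comp_zero]

/-- Representable functors are injective with respect to copresentations. -/
lemma exists_extension (h : IsCopresentation i f) {Y : C} (j : F ⟶ preadditiveYoneda.obj Y) :
    ∃ u : A ⟶ Y, i ≫ preadditiveYoneda.map u = j := by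
  obtain ⟨G, s, hs⟩ := h.exists_generator
  obtain ⟨u, hu⟩ := exists_comp_eq_of_comp_eq_zero (evalHom i s) (evalHom j s) (fun X x hx => by
    have h0 : F.map x.op s = 0 := h.ext (by rw [evalHom_map, hx, evalHom_zero])
    rw [← evalHom_map, h0, evalHom_zero])
  refine ⟨u, ?_⟩
  have key (X : C) (t : F.obj (Opposite.op X)) : evalHom i t ≫ u = evalHom j t := by
    obtain ⟨r, rfl⟩ := hs t
    rw [evalHom_map, Category.assoc, hu, evalHom_map]
  ext X t
  exact key X.unop t

end IsCopresentation

/-- The integer `χ A - χ B + χ (cone f)` attached to a morphism `f : A ⟶ B`. -/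
def defect (χ : C → ℕ) {A B : C} (f : A ⟶ B) : ℤ :=
  χ A - χ B + χ (distinguished_cocone_triangle f).choose

/-! ### The defect of a morphism -/

namespace IsSplitAdditive

variable {χ : C → ℕ} (hχ : IsSplitAdditive χ)
include hχ

lemma defect_eq {T : Triangle C} (hT : T ∈ distTriang C) :
    defect χ T.mor₁ = χ T.obj₁ - χ T.obj₂ + χ T.obj₃ := by
  have h := (distinguished_cocone_triangle T.mor₁).choose_spec.choose_spec.choose_spec
  have e : χ T.obj₃ = χ (distinguished_cocone_triangle T.mor₁).choose :=
    hχ.of_iso (Triangle.π₃.mapIso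
      (isoTriangleOfIso₁₂ _ _ hT h (Iso.refl _) (Iso.refl _)
        ((Category.comp_id _).trans (Category.id_comp _).symm)))
  rw [defect, e]

lemma eq_add_of_mor₃_eq_zero {T : Triangle C} (hT : T ∈ distTriang C) (h : T.mor₃ = 0) :
    χ T.obj₂ = χ T.obj₁ + χ T.obj₃ := by
  obtain ⟨e, -⟩ := exists_iso_binaryBiproduct_of_distTriang T hT h
  rw [hχ.of_iso e, hχ.biprod]

lemma defect_of_isSplitMono {A B : C} (f : A ⟶ B) [IsSplitMono f] : defect χ f = 0 := by
  obtain ⟨Z, g, w, hT⟩ := distinguished_cocone_triangle f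
  have h := hχ.eq_add_of_mor₃_eq_zero hT (Triangle.mor₃_eq_zero_of_mono₁ _ hT
    (inferInstanceAs (Mono f)))
  have h' := hχ.defect_eq hT
  dsimp only [Triangle.mk] at h h'
  omega

/-- The octahedral triangle on the three cones has connecting map `w₂ ≫ v₁⟦1⟧'`. If this vanishes,
the triangle splits, `χ Z₃ = χ Z₁ + χ Z₂`, and the terms `χ B` cancel. -/
lemma defect_comp [IsTriangulated C] {A B D : C} (f : A ⟶ B) (g : B ⟶ D)
    (h : ∀ ⦃X : C⦄ (x : X ⟶ B), x ≫ g = 0 → ∃ y : X ⟶ A, y ≫ f = x) :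
    defect χ (f ≫ g) = defect χ f + defect χ g := by
  obtain ⟨Z₁, v₁, w₁, h₁⟩ := distinguished_cocone_triangle f
  obtain ⟨Z₂, v₂, w₂, h₂⟩ := distinguished_cocone_triangle g
  obtain ⟨Z₃, v₃, w₃, h₃⟩ := distinguished_cocone_triangle (f ≫ g)
  have hw₂ : w₂ ≫ g⟦(1 : ℤ)⟧' = 0 := comp_distTriang_mor_zero₃₁ _ h₂
  have hv₁ : f ≫ v₁ = 0 := comp_distTriang_mor_zero₁₂ _ h₁
  have hw : w₂ ≫ v₁⟦(1 : ℤ)⟧' = 0 := by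
    -- The desuspension of `w₂` is killed by `g`, hence factors through `f`, and `f ≫ v₁ = 0`.
    let e : (Z₂⟦(-1 : ℤ)⟧)⟦(1 : ℤ)⟧ ≅ Z₂ := (shiftEquiv C (1 : ℤ)).counitIso.app Z₂
    obtain ⟨x, hx⟩ := (shiftFunctor C (1 : ℤ)).map_surjective (e.hom ≫ w₂)
    obtain ⟨y, rfl⟩ := h x ((shiftFunctor C (1 : ℤ)).map_injective (by
      rw [Functor.map_comp, hx, Functor.map_zero, Category.assoc, hw₂, comp_zero]))
    rw [← cancel_epi e.hom, ← Category.assoc, ← hx, ← Functor.map_comp, Category.assoc, hv₁]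
    simp
  let O := Triangulated.someOctahedron rfl h₁ h₂ h₃
  have hO := hχ.eq_add_of_mor₃_eq_zero O.mem hw
  have e₁ := hχ.defect_eq h₁
  have e₂ := hχ.defect_eq h₂
  have e₃ := hχ.defect_eq h₃
  dsimp only [Triangle.mk] at hO e₁ e₂ e₃
  omega

lemma defect_comp_isSplitMono [IsTriangulated C] {A B D : C} (f : A ⟶ B) (m : B ⟶ D)
    [IsSplitMono m] : defect χ (f ≫ m) = defect χ f := by
  rw [hχ.defect_comp f m fun X x hx => ⟨0, by
    rw [zero_comp, ← cancel_mono m, hx, zero_comp]⟩, hχ.defect_of_isSplitMono m, add_zero]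

/-- Each of `f`, `f'` factors through the other, so `(f, f') : A ⟶ B ⊞ B'` is both `f` followed by a
split monomorphism and `f'` followed by one. -/
lemma defect_eq_of_comp_eq_zero_iff [IsTriangulated C] {A B B' : C} (f : A ⟶ B) (f' : A ⟶ B')
    (h : ∀ ⦃X : C⦄ (x : X ⟶ A), x ≫ f = 0 ↔ x ≫ f' = 0) : defect χ f = defect χ f' := by
  obtain ⟨v, hv⟩ := exists_comp_eq_of_comp_eq_zero f f' fun X x => (h x).1
  obtain ⟨v', hv'⟩ := exists_comp_eq_of_comp_eq_zero f' f fun X x => (h x).2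
  have : IsSplitMono (biprod.lift (𝟙 B) v) := ⟨⟨⟨biprod.fst, by simp⟩⟩⟩
  have : IsSplitMono (biprod.lift v' (𝟙 B')) := ⟨⟨⟨biprod.snd, by simp⟩⟩⟩
  rw [← hχ.defect_comp_isSplitMono f (biprod.lift (𝟙 B) v),
    ← hχ.defect_comp_isSplitMono f' (biprod.lift v' (𝟙 B'))]
  congr 1
  ext <;> simp [hv, hv']

/-- The defect of a copresentation only depends on the copresented functor, up to a direct
summand of the first term. -/
lemma defect_eq_of_biprod [IsTriangulated C] {F : Cᵒᵖ ⥤ AddCommGrpCat.{v}} {A A' B D : C}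
    {i : F ⟶ preadditiveYoneda.obj A} {f : A ⟶ B} (h : IsCopresentation i f)
    {m : A ⟶ A'} [IsSplitMono m] {g : A' ⟶ D}
    (hg : IsCopresentation (i ≫ preadditiveYoneda.map m) g) : defect χ f = defect χ g := by
  have key : defect χ (m ≫ g) = defect χ g := by
    rw [hχ.defect_comp m g fun X x hx => ?_, hχ.defect_of_isSplitMono m, zero_add]
    obtain ⟨t, ht⟩ := (hg.exact x).1 hx
    exact ⟨evalHom i t, ht⟩
  rw [← key]
  refine hχ.defect_eq_of_comp_eq_zero_iff _ _ fun X x => ?_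
  rw [h.exact, ← Category.assoc, hg.exact]
  refine exists_congr fun t => ?_
  rw [evalHom_comp, cancel_mono]

/-- By injectivity of representables, the embedding `(i, i')` of `F` into `Hom(-, A ⊞ A')` is both
`i` and `i'` followed by a split monomorphism. A copresentation extending it is compared with the
two given ones. -/
lemma defect_eq_of_isCopresentation [IsTriangulated C] {F : Cᵒᵖ ⥤ AddCommGrpCat.{v}}
    {A A' B B' : C} {i : F ⟶ preadditiveYoneda.obj A} {i' : F ⟶ preadditiveYoneda.obj A'}
    {f : A ⟶ B} {f' : A' ⟶ B'} (h : IsCopresentation i f) (h' : IsCopresentation i' f') :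
    defect χ f = defect χ f' := by
  obtain ⟨u, hu⟩ := h.exists_extension i'
  obtain ⟨u', hu'⟩ := h'.exists_extension i
  have : IsSplitMono (biprod.lift (𝟙 A) u) := ⟨⟨⟨biprod.fst, by simp⟩⟩⟩
  have : IsSplitMono (biprod.lift u' (𝟙 A')) := ⟨⟨⟨biprod.snd, by simp⟩⟩⟩
  have e : i ≫ preadditiveYoneda.map (biprod.lift (𝟙 A) u) =
      i' ≫ preadditiveYoneda.map (biprod.lift u' (𝟙 A')) := by
    have h1 : biprod.lift (𝟙 A) u = biprod.inl + u ≫ biprod.inr := by ext <;> simp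
    have h2 : biprod.lift u' (𝟙 A') = u' ≫ biprod.inl + biprod.inr := by ext <;> simp
    have h3 {X Y : C} (a b : X ⟶ Y) : preadditiveYoneda.map (a + b) =
        preadditiveYoneda.map a + preadditiveYoneda.map b := by
      ext; exact Preadditive.comp_add _ _ _ _ _ _
    rw [h1, h2, h3, h3, Preadditive.comp_add, Preadditive.comp_add, Functor.map_comp,
      Functor.map_comp, reassoc_of% hu, reassoc_of% hu']
  obtain ⟨D, g, hg⟩ := h.exists_of_mono (i ≫ preadditiveYoneda.map (biprod.lift (𝟙 A) u))
    (fun X s t hst => h.ext ((cancel_mono (biprod.lift (𝟙 A) u)).1 hst))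
  rw [hχ.defect_eq_of_biprod h hg]
  rw [e] at hg
  exact (hχ.defect_eq_of_biprod h' hg).symm

end IsSplitAdditive

/-- A short exact sequence of copresented functors comes from a composable pair of morphisms. -/
lemma exists_isCopresentation_of_shortExact {S : ShortComplex (Abelianisation C)}
    (hS : (S.map (isCopresented C).ι).ShortExact) :
    ∃ (A B D : C) (f : A ⟶ B) (g : B ⟶ D) (i₁ : S.X₁.obj ⟶ preadditiveYoneda.obj A)
      (i₂ : S.X₂.obj ⟶ preadditiveYoneda.obj A) (i₃ : S.X₃.obj ⟶ preadditiveYoneda.obj B),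
      IsCopresentation i₁ f ∧ IsCopresentation i₂ (f ≫ g) ∧ IsCopresentation i₃ g ∧
        ∀ ⦃X : C⦄ (x : X ⟶ B), x ≫ g = 0 → ∃ y : X ⟶ A, y ≫ f = x := by
  obtain ⟨A, B₀, i, f₀, hi⟩ := exists_isCopresentation S.X₂.property
  obtain ⟨_, _, i₁', f₁', hi₁'⟩ := exists_isCopresentation S.X₁.property
  obtain ⟨_, _, i₃', f₃', hi₃'⟩ := exists_isCopresentation S.X₃.property
  have hα := (mono_iff_injective_app _).1 hS.mono_f
  have hβ := (epi_iff_surjective_app _).1 hS.epi_g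
  have := hS.epi_g
  obtain ⟨B, f, hf⟩ := hi₁'.exists_of_mono (S.f.hom ≫ i)
    (fun X => (hi.injective X).comp (hα X))
  obtain ⟨_, wf, -⟩ := (isCopresentation_iff _ _).1 hf
  -- The quotient `S.X₃` embeds into `Hom(-, A)` modulo `S.X₁`, which embeds into `Hom(-, B)`
  -- through `f`.
  let k : S.X₃.obj ⟶ preadditiveYoneda.obj B :=
    hS.exact.desc (i ≫ preadditiveYoneda.map f) ((Category.assoc _ _ _).symm.trans wf)
  have hk : S.g.hom ≫ k = i ≫ preadditiveYoneda.map f := hS.exact.g_desc _ _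
  have hk' {X : C} (t : S.X₂.obj.obj (Opposite.op X)) :
      evalHom k (S.g.hom.app _ t) = evalHom i t ≫ f :=
    ConcreteCategory.congr_hom (NatTrans.congr_app hk (Opposite.op X)) t
  have hw {X : C} (t : S.X₁.obj.obj (Opposite.op X)) :
      S.g.hom.app _ (S.f.hom.app _ t) = 0 :=
    ConcreteCategory.congr_hom (NatTrans.congr_app (S.map (isCopresented C).ι).zero
      (Opposite.op X)) t
  obtain ⟨D, g, hg⟩ := hi₃'.exists_of_mono k (fun X => by
    rw [injective_iff_map_eq_zero]
    intro t ht
    obtain ⟨t, rfl⟩ := hβ X t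
    obtain ⟨s, hs⟩ := (hf.exact (X := X.unop) (evalHom i t)).1 ((hk' t).symm.trans ht)
    rw [← hi.injective _ hs]
    exact hw (X := X.unop) s)
  have hfg {X : C} (x : X ⟶ B) (hx : x ≫ g = 0) :
      ∃ t : S.X₂.obj.obj (Opposite.op X), evalHom i t ≫ f = x := by
    obtain ⟨t, ht⟩ := (hg.exact x).1 hx
    obtain ⟨t, rfl⟩ := hβ _ t
    exact ⟨t, (hk' t).symm.trans ht⟩
  refine ⟨A, B, D, f, g, _, i, k, hf, ⟨hi.injective, fun {X} x => ⟨fun hx => ?_, ?_⟩⟩, hg,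
    fun X x hx => ?_⟩
  -- The element `t` of `S.X₂` has the same image under `f` as `x`, so the difference comes from
  -- `S.X₁`.
  · obtain ⟨t, ht⟩ := hfg (x ≫ f) (by rwa [Category.assoc])
    obtain ⟨s, hs⟩ := (hf.exact (x - evalHom i t)).1
      (by rw [Preadditive.sub_comp, ht, sub_self])
    refine ⟨S.f.hom.app _ s + t, ?_⟩
    rw [evalHom_add]
    exact eq_sub_iff_add_eq.1 hs
  · rintro ⟨t, rfl⟩
    rw [← Category.assoc, ← hk']
    exact (hg.exact _).2 ⟨_, rfl⟩
  · obtain ⟨t, ht⟩ := hfg x hx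
    exact ⟨_, ht⟩

end

/-! ### Alternating sums of triangles, and shifted copresentations -/

section

variable {C : Type u} [Category.{v} C] [HasShift C ℤ]

/-- The function `χ` vanishes on the `n`-th shift of each object of the triangle `T`. -/
def VanishesAt (χ : C → ℕ) (T : Triangle C) (n : ℤ) : Prop :=
  χ (T.obj₁⟦n⟧) = 0 ∧ χ (T.obj₂⟦n⟧) = 0 ∧ χ (T.obj₃⟦n⟧) = 0

lemma VanishesAt.euler_eq_zero {χ : C → ℕ} {T : Triangle C} {n : ℤ} (h : VanishesAt χ T n) :
    euler χ T n = 0 := by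
  simp [euler, h.1, h.2.1, h.2.2]

lemma extensionSum_congr {χ : C → ℕ} {T T' : Triangle C} (h : euler χ T = euler χ T') (n : ℤ) :
    extensionSum χ T n = extensionSum χ T' n := by
  change (if 0 ≤ n then ∑ i ∈ Finset.Icc 0 n, (i.negOnePow : ℤ) * euler χ T i
    else ∑ i ∈ Finset.Icc n (-1), ((i + 1).negOnePow : ℤ) * euler χ T i) = _
  rw [h]
  rfl

lemma extensionSum_eq_add {χ : C → ℕ} {T T' T'' : Triangle C}
    (h : ∀ n, euler χ T n = euler χ T' n + euler χ T'' n) (n : ℤ) :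
    extensionSum χ T n = extensionSum χ T' n + extensionSum χ T'' n := by
  change (if 0 ≤ n then ∑ i ∈ Finset.Icc 0 n, (i.negOnePow : ℤ) * euler χ T i
    else ∑ i ∈ Finset.Icc n (-1), ((i + 1).negOnePow : ℤ) * euler χ T i) =
    (if 0 ≤ n then ∑ i ∈ Finset.Icc 0 n, (i.negOnePow : ℤ) * euler χ T' i
    else ∑ i ∈ Finset.Icc n (-1), ((i + 1).negOnePow : ℤ) * euler χ T' i) +
    (if 0 ≤ n then ∑ i ∈ Finset.Icc 0 n, (i.negOnePow : ℤ) * euler χ T'' i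
    else ∑ i ∈ Finset.Icc n (-1), ((i + 1).negOnePow : ℤ) * euler χ T'' i)
  simp only [h, mul_add, Finset.sum_add_distrib]
  split_ifs <;> rfl

end

section

variable {C : Type u} [Category.{v} C] [Preadditive C] [HasShift C ℤ]
  [∀ n : ℤ, (shiftFunctor C n).Additive]

/-- The sign does not affect kernels; it is there to match the first map of the shifted triangle. -/
lemma IsCopresentation.shift {F : Cᵒᵖ ⥤ AddCommGrpCat.{v}} {A B : C}
    {i : F ⟶ preadditiveYoneda.obj A} {f : A ⟶ B} (h : IsCopresentation i f) (n : ℤ) :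
    IsCopresentation (Functor.whiskerLeft (shiftFunctor C (-n)).op i ≫ (yonedaShiftIso n A).hom)
      (n.negOnePow • f⟦n⟧') := by
  let adj := (shiftEquiv' C (-n) n (neg_add_cancel n)).toAdjunction
  have : (shiftEquiv' C (-n) n (neg_add_cancel n)).functor.Additive :=
    inferInstanceAs (shiftFunctor C (-n)).Additive
  have hev {X : C} (t : F.obj (Opposite.op (X⟦-n⟧))) :
      evalHom (Functor.whiskerLeft (shiftFunctor C (-n)).op i ≫ (yonedaShiftIso n A).hom)
        (X := X) t = adj.homEquiv X A (evalHom i t) := rfl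
  refine ⟨fun X s t hst => ?_, fun {X} x => ?_⟩
  · exact h.ext ((adj.homEquiv _ _).injective ((hev s).symm.trans (hst.trans (hev t))))
  · obtain ⟨y, hy⟩ := (adj.homEquiv X A).surjective x
    trans y ≫ f = 0
    · have h0 : x ≫ f⟦n⟧' = adj.homEquiv X B (y ≫ f) := by
        rw [← hy]
        exact (adj.homEquiv_naturality_right y f).symm
      rw [Linear.comp_units_smul, smul_eq_zero_iff_eq, h0]
      exact (adj.homAddEquiv X B).map_eq_zero_iff
    · rw [h.exact]
      refine exists_congr fun t => ?_
      refine (adj.homEquiv X A).injective.eq_iff.symm.trans ?_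
      rw [hy]
      exact Iff.rfl

end

/-! ### Cohomological functions extend to additive functions -/

section

variable {C : Type u} [Category.{v} C] [Preadditive C] [HasZeroObject C] [HasShift C ℤ]
  [∀ n : ℤ, (shiftFunctor C n).Additive] [Pretriangulated C]

namespace IsCohomologicalFunction

variable {χ : C → ℕ} (hχ : IsCohomologicalFunction χ)
include hχ

lemma isSplitAdditive : IsSplitAdditive χ := hχ.map_biprod

lemma isSplitAdditive_shift (n : ℤ) : IsSplitAdditive (fun X => χ (X⟦n⟧)) :=
  hχ.isSplitAdditive.comp (shiftFunctor C n)

lemma exists_vanishesAt (T T' T'' : Triangle C) :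
    ∃ n, VanishesAt χ T n ∧ VanishesAt χ T' n ∧ VanishesAt χ T'' n := by
  obtain ⟨n, hn⟩ := hχ.exists_shift_eq_zero
    ((T.obj₁ ⊞ T.obj₂ ⊞ T.obj₃) ⊞ (T'.obj₁ ⊞ T'.obj₂ ⊞ T'.obj₃) ⊞
      (T''.obj₁ ⊞ T''.obj₂ ⊞ T''.obj₃))
  refine ⟨n, ?_⟩
  have h := (hχ.isSplitAdditive_shift n).biprod
  simp only [h] at hn
  simp only [VanishesAt]
  omega

/-- With `p` a primitive of the whole long sequence, the two sums differ by `p (3 * m) - p (3 * n)`.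
The equality axiom between the zeros at positions `3 * n` and `3 * m` makes this vanish. -/
lemma extensionSum_eq_of_vanishesAt {T : Triangle C} (hT : T ∈ distTriang C) {m n : ℤ}
    (hm : VanishesAt χ T m) (hn : VanishesAt χ T n) :
    extensionSum χ T m = extensionSum χ T n := by
  obtain ⟨p, hp, -⟩ := exists_isAltPrimitive (fun i => χ (triangleSeq T i))
  have hq := isAltPrimitive_euler hp
  rw [extensionSum_eq hq hm.euler_eq_zero, extensionSum_eq hq hn.euler_eq_zero, sub_left_inj]
  have hm' : χ (triangleSeq T (3 * m)) = 0 := by rw [triangleSeq_three_mul]; exact hm.1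
  have hn' : χ (triangleSeq T (3 * m - 3 * n + 3 * n)) = 0 := by rwa [sub_add_cancel]
  have hn'' : χ (triangleSeq T (3 * n)) = 0 := by rw [triangleSeq_three_mul]; exact hn.1
  have h := hχ.altSum_eq_zero T hT (3 * n) hn'' _ hn'
  rw [altSum_eq (y := fun i => χ (triangleSeq T i)) hp hn'', sub_add_cancel] at h
  have h1 := hp.succ_eq_of_eq_zero (n := 3 * m) (by rw [hm', Nat.cast_zero])
  split_ifs at h with h0 <;> simp at h <;> omega

lemma extensionSum_nonneg {T : Triangle C} (hT : T ∈ distTriang C) {n : ℤ}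
    (hn : VanishesAt χ T n) : 0 ≤ extensionSum χ T n := by
  obtain ⟨p, hp, hp0⟩ := exists_isAltPrimitive (fun i => χ (triangleSeq T i))
  have hq := isAltPrimitive_euler hp
  have hn' : χ (triangleSeq T (3 * n)) = 0 := by rw [triangleSeq_three_mul]; exact hn.1
  rw [extensionSum_eq hq hn.euler_eq_zero, mul_zero, hp0, sub_zero]
  -- The sum equals `p (3 * n)`. The inequality axiom is based at position `3 * n` and stopped at
  -- position `-1` if `n < 0`, or `0` if `n ≥ 0`; both choices give the sign `+1` in front of `p (3
  -- * n)`.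
  have key (m : ℤ) := hχ.altSum_nonneg T hT (3 * n) hn' m
  simp only [altSum_eq (y := fun i => χ (triangleSeq T i)) hp hn'] at key
  rcases lt_or_ge n 0 with h | h
  · have := key (-1 - 3 * n)
    rw [if_pos (by omega), sub_add_cancel] at this
    simpa [hp0] using this
  · have := key (-(3 * n))
    rw [neg_add_cancel, zero_add, Int.negOnePow_zero, hp0] at this
    split_ifs at this with h0
    · obtain rfl : n = 0 := by omega
      simp [hp0]
    · simpa using this

lemma euler_eq_defect {T : Triangle C} (hT : T ∈ distTriang C) (n : ℤ) :
    euler χ T n = defect (fun X => χ (X⟦n⟧)) T.mor₁ :=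
  ((hχ.isSplitAdditive_shift n).defect_eq hT).symm

lemma euler_eq_of_isCopresentation [IsTriangulated C] {F : Cᵒᵖ ⥤ AddCommGrpCat.{v}}
    {T T' : Triangle C} (hT : T ∈ distTriang C) (hT' : T' ∈ distTriang C)
    {i : F ⟶ preadditiveYoneda.obj T.obj₁} {i' : F ⟶ preadditiveYoneda.obj T'.obj₁}
    (hi : IsCopresentation i T.mor₁) (hi' : IsCopresentation i' T'.mor₁) :
    euler χ T = euler χ T' := by
  ext n
  rw [hχ.euler_eq_defect hT, hχ.euler_eq_defect hT']
  exact (hχ.isSplitAdditive_shift n).defect_eq_of_isCopresentation hi hi'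

lemma exists_value [IsTriangulated C] (F : Abelianisation C) :
    ∃ m : ℕ, ∀ T ∈ distTriang C, ∀ i : F.obj ⟶ preadditiveYoneda.obj T.obj₁,
      IsCopresentation i T.mor₁ → ∀ n, VanishesAt χ T n → (m : ℤ) = extensionSum χ T n := by
  obtain ⟨A, B, i, f, hi⟩ := exists_isCopresentation F.property
  obtain ⟨Z, g, h, hT⟩ := distinguished_cocone_triangle f
  obtain ⟨n, hn, -⟩ := hχ.exists_vanishesAt (Triangle.mk f g h) (Triangle.mk f g h)
    (Triangle.mk f g h)
  refine ⟨(extensionSum χ (Triangle.mk f g h) n).toNat, fun T' hT' i' hi' n' hn' => ?_⟩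
  -- The two triangles may vanish at different shifts; passing to a common one allows comparison of
  -- the sums termwise.
  obtain ⟨m, hm, hm', -⟩ := hχ.exists_vanishesAt (Triangle.mk f g h) T' T'
  rw [Int.toNat_of_nonneg (hχ.extensionSum_nonneg hT hn),
    hχ.extensionSum_eq_of_vanishesAt hT hn hm,
    extensionSum_congr (hχ.euler_eq_of_isCopresentation hT hT' hi hi'),
    hχ.extensionSum_eq_of_vanishesAt hT' hm' hn']

open ZeroObject in
/-- Every cohomological function extends to an additive function. -/
theorem exists_isAdditiveFunction [IsTriangulated C] :
    ∃ ψ : Abelianisation C → ℕ, IsAdditiveFunction ψ ∧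
      (fun X => ψ ((yonedaAb C).obj X)) = χ := by
  choose ψ hψ using hχ.exists_value
  refine ⟨ψ, ⟨fun S hS => ?_, fun F => ?_⟩, ?_⟩
  · obtain ⟨A, B, D, f, g, i₁, i₂, i₃, h₁, h₂, h₃, hfg⟩ :=
      exists_isCopresentation_of_shortExact hS
    obtain ⟨Z₁, v₁, w₁, hT₁⟩ := distinguished_cocone_triangle f
    obtain ⟨Z₂, v₂, w₂, hT₂⟩ := distinguished_cocone_triangle (f ≫ g)
    obtain ⟨Z₃, v₃, w₃, hT₃⟩ := distinguished_cocone_triangle g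
    obtain ⟨n, hn₁, hn₂, hn₃⟩ := hχ.exists_vanishesAt (Triangle.mk f v₁ w₁)
      (Triangle.mk (f ≫ g) v₂ w₂) (Triangle.mk g v₃ w₃)
    zify
    rw [hψ _ _ hT₁ i₁ h₁ n hn₁, hψ _ _ hT₂ i₂ h₂ n hn₂, hψ _ _ hT₃ i₃ h₃ n hn₃]
    refine extensionSum_eq_add (fun m => ?_) n
    rw [hχ.euler_eq_defect hT₁, hχ.euler_eq_defect hT₂, hχ.euler_eq_defect hT₃]
    exact (hχ.isSplitAdditive_shift m).defect_comp f g hfg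
  · obtain ⟨A, B, i, f, hi⟩ := exists_isCopresentation F.property
    obtain ⟨Z, g, h, hT⟩ := distinguished_cocone_triangle f
    obtain ⟨n, hn, -⟩ := hχ.exists_vanishesAt (Triangle.mk f g h) (Triangle.mk f g h)
      (Triangle.mk f g h)
    refine ⟨n, ?_⟩
    -- The shifted triangle vanishes at `0`, where the defining sum has a single term.
    have h0 : VanishesAt χ ((Triangle.shiftFunctor C n).obj (Triangle.mk f g h)) 0 := by
      have e (X : C) : χ ((X⟦n⟧)⟦(0 : ℤ)⟧) = χ (X⟦n⟧) :=
        hχ.isSplitAdditive.of_iso ((shiftFunctorZero C ℤ).app _)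
      exact ⟨(e _).trans hn.1, (e _).trans hn.2.1, (e _).trans hn.2.2⟩
    have := hψ (shiftAb n F) _ (Triangle.shift_distinguished _ hT n) _ (hi.shift n) 0 h0
    zify
    rw [this]
    simpa [extensionSum] using! h0.euler_eq_zero
  · ext X
    have hT := contractible_distinguished₂ X
    obtain ⟨n, hn, -⟩ := hχ.exists_vanishesAt (Triangle.mk (0 : X ⟶ 0) 0 (𝟙 (X⟦(1 : ℤ)⟧)))
      (Triangle.mk (0 : X ⟶ 0) 0 (𝟙 (X⟦(1 : ℤ)⟧))) (Triangle.mk (0 : X ⟶ 0) 0 (𝟙 (X⟦(1 : ℤ)⟧)))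
    -- For `X ⟶ 0 ⟶ ΣX` the terms are `χ (ΣᵐX) + χ (Σᵐ⁺¹X)`, so the sum telescopes to `χ X`.
    have hq : IsAltPrimitive (euler χ (Triangle.mk (0 : X ⟶ 0) 0 (𝟙 (X⟦(1 : ℤ)⟧)))) _ :=
      .of_add (K := fun n => (χ (X⟦n⟧) : ℤ)) fun m => by
        have e₁ : χ ((0 : C)⟦m⟧) = 0 := hχ.isSplitAdditive.eq_zero_of_isZero
          ((shiftFunctor C m).map_isZero (isZero_zero C))
        have e₂ : χ ((X⟦(1 : ℤ)⟧)⟦m⟧) = χ (X⟦m + 1⟧) :=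
          hχ.isSplitAdditive.of_iso ((shiftFunctorAdd' C 1 m (m + 1) (add_comm _ _)).app X).symm
        change (χ (X⟦m⟧) : ℤ) - χ ((0 : C)⟦m⟧) + χ ((X⟦(1 : ℤ)⟧)⟦m⟧) = _
        rw [e₁, e₂, Nat.cast_zero, sub_zero]
    have e : χ (X⟦(0 : ℤ)⟧) = χ X := hχ.isSplitAdditive.of_iso ((shiftFunctorZero C ℤ).app X)
    have hX : χ (X⟦n⟧) = 0 := hn.1
    have := hψ ((yonedaAb C).obj X) _ hT (𝟙 (preadditiveYoneda.obj X))
      (isCopresentation_zero (Iso.refl _)) n hn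
    rw [extensionSum_eq hq hn.euler_eq_zero] at this
    simpa [hX, e] using this

end IsCohomologicalFunction

end

end CohFun

end

theorem mainTheorem10 {C : Type u} [Category.{v} C] [Preadditive C] [HasZeroObject C]
    [HasShift C ℤ] [∀ n : ℤ, (shiftFunctor C n).Additive] [Pretriangulated C]
    [IsTriangulated C] :
    Set.BijOn
      (fun (χ : CohFun.Abelianisation C → ℕ) (X : C) => χ ((CohFun.yonedaAb C).obj X))
      {χ | CohFun.IsAdditiveFunction χ} {χ | CohFun.IsCohomologicalFunction χ} ∧
    ∀ χ : CohFun.Abelianisation C → ℕ, CohFun.IsAdditiveFunction χ →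
      ∀ T ∈ distTriang C, ∀ (F : CohFun.Abelianisation C)
        (i : F.obj ⟶ preadditiveYoneda.obj T.obj₁)
        (w : i ≫ preadditiveYoneda.map T.mor₁ = 0),
        Mono i → (ShortComplex.mk i (preadditiveYoneda.map T.mor₁) w).Exact →
        ∀ n : ℤ, χ ((CohFun.yonedaAb C).obj ((T.obj₁ ⊞ T.obj₂ ⊞ T.obj₃)⟦n⟧)) = 0 →
          (χ F : ℤ) =
            CohFun.extensionSum (fun X => χ ((CohFun.yonedaAb C).obj X)) T n := by
  refine ⟨⟨fun χ hχ => hχ.isCohomologicalFunction, fun χ hχ ψ hψ h => ?_, fun χ hχ => ?_⟩,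
    fun χ hχ T hT F i w hi hex n hn =>
      hχ.eq_extensionSum hT ((CohFun.isCopresentation_iff _ _).2 ⟨hi, w, hex⟩) hn⟩
  -- Injectivity: the formula expresses both functions through their common restriction.
  · ext F
    obtain ⟨A, B, i, f, hi⟩ := CohFun.exists_isCopresentation F.property
    obtain ⟨Z, g, k, hT⟩ := distinguished_cocone_triangle f
    obtain ⟨n, hn⟩ := hχ.isCohomologicalFunction.exists_shift_eq_zero (A ⊞ B ⊞ Z)
    zify
    rw [hχ.eq_extensionSum hT hi hn, hψ.eq_extensionSum hT hi ((congrFun h _).symm.trans hn)]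
    exact congrArg (CohFun.extensionSum · (Triangle.mk f g k) n) h
  · obtain ⟨ψ, hψ, h⟩ := hχ.exists_isAdditiveFunction
    exact ⟨ψ, hψ, h⟩
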